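/- Toss independent coins, each returning heads with probability $p=2/3$ and tails with probability $1/3$. Let $\Delta_i$ be the number of heads minus the number of tails among the first $i$ tosses. When $N$ coins are tossed, the heads among them are colored as follows: if the $i$-th toss is a head, it is colored red if and only if (1) $\Delta_j\ge\Delta_i$ for all $j=i+1,\dots,N$, and (2) whenever $1\le k<i$ and $\Delta_k\ge\Delta_i$, there is $l\in(k,i)$ with $\Delta_l<\Delta_i$; otherwise it is colored blue. A run of $k$ blue heads means $k$ heads that are consecutive in the sequence of heads (tails in between are ignored), all of them blue. Let $L_N$ be the length of the longest run of blue heads when $N$ coins are tossed, and let $\tau_N$ be the number of tosses needed to obtain $N$ heads. **Proposition 2.5.** (a) For all sufficiently large $N$, the expected length of the longest run of blue heads among $N$ tosses satisfies $$\mathbb{E}[L_N]\ \ge\ 2\log_2 N=\frac{\log N}{\log\sqrt2}.$$ The same holds when one tosses until $N$ heads have appeared: $\mathbb{E}[L_{\tau_N}]\ge 2\log_2 N$ for all sufficiently large $N$. (b) At most on the order of $2^{k/2}$ tosses are needed to see a run of $k$ blue heads with any prescribed probability less than $1$: for every $\delta<1$ there are $C>0$ and $k_0$ such that for all $k\ge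 k_0$ and all integers $N\ge C\,2^{k/2}$, the probability that a run of $k$ blue heads occurs when $N$ coins are tossed is at least $\delta$. -/

import Mathlib

open MeasureTheory ProbabilityTheory

namespace CoinRuns

/-! A sequence of tosses is a function `ω : ℕ → Bool`; for `i ≥ 1` the `i`-th toss is a head iff
`ω i = true`. The coordinate `ω 0` plays no role. -/

/-- Number of heads among the first `i` tosses. -/
def headCount (ω : ℕ → Bool) (i : ℕ) : ℕ :=
  ((Finset.Icc 1 i).filter fun j => ω j = true).card

/-- Number of tails among the first `i` tosses. -/
def tailCount (ω : ℕ → Bool) (i : ℕ) : ℕ :=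
  ((Finset.Icc 1 i).filter fun j => ω j = false).card

/-- `Δ_i`: heads minus tails among the first `i` tosses. -/
def delta (ω : ℕ → Bool) (i : ℕ) : ℤ :=
  (headCount ω i : ℤ) - (tailCount ω i : ℤ)

/-- When `N` coins are tossed, the `i`-th toss is a head that is colored red. -/
def IsRed (ω : ℕ → Bool) (N i : ℕ) : Prop :=
  i ∈ Finset.Icc 1 N ∧ ω i = true ∧
    (∀ j ∈ Finset.Icc (i + 1) N, delta ω i ≤ delta ω j) ∧
    (∀ k ∈ Finset.Ico 1 i, delta ω i ≤ delta ω k →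
      ∃ l ∈ Finset.Ioo k i, delta ω l < delta ω i)

/-- When `N` coins are tossed, the `i`-th toss is a head that is colored blue. -/
def IsBlue (ω : ℕ → Bool) (N i : ℕ) : Prop :=
  i ∈ Finset.Icc 1 N ∧ ω i = true ∧ ¬ IsRed ω N i

/-- When `N` coins are tossed, there are `k` heads, consecutive in the sequence of heads (tails
in between are ignored), all of which are blue: some interval of tosses contains exactly `k`
heads, and every head in it is blue. -/
def HasBlueRun (ω : ℕ → Bool) (N k : ℕ) : Prop :=
  ∃ a b : ℕ, 1 ≤ a ∧ b ≤ N ∧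
    (∀ i ∈ Finset.Icc a b, ω i = true → IsBlue ω N i) ∧
    ((Finset.Icc a b).filter fun i => ω i = true).card = k

/-- Length of the longest run of consecutive blue heads when `N` coins are tossed. -/
noncomputable def longestBlueRun (ω : ℕ → Bool) (N : ℕ) : ℕ :=
  sSup {k | HasBlueRun ω N k}

theorem HasBlueRun.le {ω : ℕ → Bool} {N k : ℕ} (h : HasBlueRun ω N k) : k ≤ N := by
  obtain ⟨a, b, ha, hb, -, rfl⟩ := h
  refine (Finset.card_filter_le _ _).trans ?_
  rw [Nat.card_Icc]
  omega

/-- The supremum that defines `longestBlueRun` is a maximum. -/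
theorem hasBlueRun_longestBlueRun (ω : ℕ → Bool) (N : ℕ) :
    HasBlueRun ω N (longestBlueRun ω N) := by
  refine Nat.sSup_mem (s := {k | HasBlueRun ω N k}) ⟨0, 1, 0, le_rfl, Nat.zero_le _, ?_, ?_⟩
    ⟨N, fun k hk => HasBlueRun.le hk⟩
  · intro i hi
    simp at hi
  · simp

/-- The number of tosses needed to obtain `n` heads. (It is `0` by convention if there are fewer
than `n` heads in the whole sequence, which has probability zero when heads have positive
probability.) -/
noncomputable def headTime (ω : ℕ → Bool) (n : ℕ) : ℕ :=
  sInf {m | headCount ω m = n}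

/-- The law of an infinite sequence of independent tosses of a coin returning heads with
probability `p`. -/
noncomputable def tossLaw (p : unitInterval) : Measure (ℕ → Bool) :=
  Measure.infinitePi fun _ : ℕ => bernoulliMeasure true false p

/-- The head probability `2/3`. -/
noncomputable def twoThirds : unitInterval :=
  ⟨2 / 3, by norm_num, by norm_num⟩

end CoinRuns

/-! A head is blue as soon as the walk `delta` later drops below the level it reached with that
head. (Condition (2) for red heads is automatic, since `delta` is lower just before a head.) So if
the `2 * k` tosses of a window spell a Dyck word, heads being up-steps, then all its `k` heads are
blue whatever the other tosses are: each head ends strictly above the level at which the window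
starts, and the window returns to that level (`hasBlueRun_of_word`).

A window spells a Dyck word with probability `catalan k * (2 / 9) ^ k`, which is `(8 / 9) ^ k` up to a
polynomial factor. Among `N ≥ (5 / 4) ^ k` tosses there are about `N / (2 * k)` disjoint, hence
independent, windows. The expected number of Dyck words among them is of order `(10 / 9) ^ k` up to a
polynomial factor, so the probability of finding none tends to `0`
(`eventually_le_tossLaw_real_hasBlueRun`).

Since `5 / 4 < √2`, this gives the bound on the number of tosses with `C = 1`. Since `(5 / 4) ^ 3 < 2`,
it also gives a run of length `3 * Nat.log 2 N` with probability at least `5 / 6`, and Markov's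
inequality bounds the expectation below. The longest blue run is monotone in the number of tosses,
and almost surely at least `N` tosses are made by the time `N` heads have appeared, so tossing until
then can only increase the expectation (`integral_longestBlueRun_le_headTime`). -/

namespace CoinRuns

/-! ### Events that depend on finitely many tosses -/

instance isProbabilityMeasure_tossLaw (p : unitInterval) : IsProbabilityMeasure (tossLaw p) := by
  unfold tossLaw; infer_instance

/-- A function of the tosses in a finite set `S` factors through the restriction to `S`; the tosses
outside `S` are filled in with tails. -/
theorem eq_comp_restrict_of_dependsOn {β : Type*} {f : (ℕ → Bool) → β} {S : Finset ℕ}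
    (hf : DependsOn f (S : Set ℕ)) :
    f = (fun x : S → Bool => f fun i => if h : i ∈ S then x ⟨i, h⟩ else false) ∘
      fun ω i => ω i := by
  funext ω
  refine hf fun i hi => ?_
  have hi' : i ∈ S := hi
  simp [hi']

theorem measurable_of_dependsOn {β : Type*} [MeasurableSpace β] {f : (ℕ → Bool) → β}
    {S : Finset ℕ} (hf : DependsOn f (S : Set ℕ)) : Measurable f := by
  rw [eq_comp_restrict_of_dependsOn hf]
  exact (measurable_of_finite _).comp (by fun_prop)

theorem measurableSet_of_dependsOn {A : Set (ℕ → Bool)} {S : Finset ℕ}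
    (hA : DependsOn (· ∈ A) (S : Set ℕ)) : MeasurableSet A :=
  measurableSet_setOfPred.2 (measurable_of_dependsOn hA)

/-- Events that depend on disjoint finite sets of tosses are independent. -/
theorem tossLaw_real_inter {p : unitInterval} {A B : Set (ℕ → Bool)} {S T : Finset ℕ}
    (hA : DependsOn (· ∈ A) (S : Set ℕ)) (hB : DependsOn (· ∈ B) (T : Set ℕ))
    (hST : Disjoint S T) :
    (tossLaw p).real (A ∩ B) = (tossLaw p).real A * (tossLaw p).real B := by
  have hind : iIndepFun (fun (i : ℕ) (ω : ℕ → Bool) => ω i) (tossLaw p) :=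
    iIndepFun_infinitePi (X := fun _ b => b) fun _ => measurable_id
  have h := hind.indepFun_finset S T hST fun i => measurable_pi_apply i
  have hA' := eq_comp_restrict_of_dependsOn hA
  have hB' := eq_comp_restrict_of_dependsOn hB
  have key := (h.comp (φ := fun x : S → Bool => (fun i => if h : i ∈ S then x ⟨i, h⟩ else false) ∈ A)
    (ψ := fun x : T → Bool => (fun i => if h : i ∈ T then x ⟨i, h⟩ else false) ∈ B)
    (measurable_of_finite _) (measurable_of_finite _)).measure_inter_preimage_eq_mul
      {True} {True} (measurableSet_singleton _) (measurableSet_singleton _)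
  -- The composed indicators are, up to unfolding `∘`, the factorizations of `A` and `B`.
  erw [← hA', ← hB'] at key
  have e (C : Set (ℕ → Bool)) : (· ∈ C) ⁻¹' {True} = C := by ext; simp
  rw [e, e] at key
  simp [measureReal_def, key]

/-! ### Words of tosses -/

/-- The step of the walk `delta` that a toss stands for: heads up, tails down. -/
def step (b : Bool) : DyckStep := if b then DyckStep.U else DyckStep.D

/-- The word spelled by the tosses `s + 1, …, s + n`. -/
def word (ω : ℕ → Bool) (s n : ℕ) : List DyckStep :=
  (List.range' (s + 1) n).map fun i => step (ω i)

theorem word_congr {ω ω' : ℕ → Bool} {s n : ℕ}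
    (h : ∀ i ∈ Finset.Icc (s + 1) (s + n), ω i = ω' i) : word ω s n = word ω' s n := by
  refine List.map_congr_left fun i hi => ?_
  rw [List.mem_range'_1] at hi
  rw [h i (Finset.mem_Icc.2 (by omega))]

theorem tossLaw_real_step (i : ℕ) (x : DyckStep) :
    (tossLaw twoThirds).real {ω | step (ω i) = x} =
      if x = DyckStep.U then 2 / 3 else 1 / 3 := by
  have h := map_measureReal_apply (μ := tossLaw twoThirds) (f := fun ω : ℕ → Bool => ω i)
    (measurable_pi_apply i) (s := {b | step b = x}) (Set.toFinite _).measurableSet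
  rw [tossLaw, Measure.infinitePi_map_eval] at h
  refine h.symm.trans ?_
  classical
  rw [bernoulliMeasure_real_apply _ (Set.toFinite _).measurableSet]
  cases x
  · simp [step, twoThirds]
  · simp [step, twoThirds]
    norm_num

theorem tossLaw_real_word (l : List DyckStep) (s : ℕ) :
    (tossLaw twoThirds).real {ω | word ω s l.length = l} =
      (2 / 3) ^ l.count DyckStep.U * (1 / 3) ^ l.count DyckStep.D := by
  induction l generalizing s with
  | nil => simp [word]
  | cons x l ih =>
    have e : {ω | word ω s (x :: l).length = x :: l} =
        {ω | step (ω (s + 1)) = x} ∩ {ω | word ω (s + 1) l.length = l} := by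
      ext ω
      simp [word, List.range'_succ]
    rw [e, tossLaw_real_inter (S := {s + 1})
      (T := Finset.Icc (s + 1 + 1) (s + 1 + l.length)), ih, tossLaw_real_step]
    · cases x <;> simp <;> ring
    · intro ω ω' h
      simp [h (s + 1) (by simp)]
    · intro ω ω' h
      simp [word_congr (fun i hi => h i hi)]
    · simp

/-! ### Dyck windows produce blue runs -/

theorem headCount_succ (ω : ℕ → Bool) (i : ℕ) :
    headCount ω (i + 1) = headCount ω i + if ω (i + 1) = true then 1 else 0 := by
  simp only [headCount, Finset.card_filter, Finset.sum_Icc_succ_top (Nat.le_add_left 1 i)]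

theorem tailCount_succ (ω : ℕ → Bool) (i : ℕ) :
    tailCount ω (i + 1) = tailCount ω i + if ω (i + 1) = false then 1 else 0 := by
  simp only [tailCount, Finset.card_filter, Finset.sum_Icc_succ_top (Nat.le_add_left 1 i)]

theorem word_succ (ω : ℕ → Bool) (s n : ℕ) :
    word ω s (n + 1) = word ω s n ++ [step (ω (s + n + 1))] := by
  rw [word, List.range'_1_concat]
  simp [word, add_right_comm]

theorem take_word (ω : ℕ → Bool) (s : ℕ) {m n : ℕ} (h : m ≤ n) :
    (word ω s n).take m = word ω s m := by
  obtain ⟨d, rfl⟩ := Nat.exists_eq_add_of_le h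
  rw [word, ← List.range'_append_1, ← List.map_take, List.take_left' List.length_range', word]

theorem headCount_add (ω : ℕ → Bool) (s n : ℕ) :
    headCount ω (s + n) = headCount ω s + (word ω s n).count DyckStep.U := by
  induction n with
  | zero => simp [word]
  | succ n ih =>
    rw [← add_assoc, headCount_succ, ih, word_succ]
    cases h : ω (s + n + 1) <;> simp [step, add_assoc]

theorem delta_succ (ω : ℕ → Bool) (i : ℕ) :
    delta ω (i + 1) = delta ω i + if ω (i + 1) = true then 1 else -1 := by
  rw [delta, delta, headCount_succ, tailCount_succ]
  cases ω (i + 1) <;> simp <;> ring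

theorem delta_add (ω : ℕ → Bool) (s n : ℕ) :
    delta ω (s + n) = delta ω s + (word ω s n).count DyckStep.U -
      (word ω s n).count DyckStep.D := by
  induction n with
  | zero => simp [word]
  | succ n ih =>
    rw [← add_assoc, delta_succ, ih, word_succ]
    cases h : ω (s + n + 1) <;> simp [step] <;> ring

theorem card_heads_Icc (ω : ℕ → Bool) (s n : ℕ) :
    ((Finset.Icc (s + 1) (s + n)).filter fun i => ω i = true).card =
      (word ω s n).count DyckStep.U := by
  induction n with
  | zero => simp [word]
  | succ n ih =>
    rw [Finset.card_filter] at ih ⊢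
    rw [← add_assoc, Finset.sum_Icc_succ_top (by omega), ih, word_succ]
    cases h : ω (s + n + 1) <;> simp [step]

/-- A head is blue as soon as the walk drops below its level later on: condition (1) for being red
fails. -/
theorem isBlue_of_delta_lt {ω : ℕ → Bool} {N i j : ℕ} (hi : 1 ≤ i) (hij : i < j) (hj : j ≤ N)
    (hω : ω i = true) (h : delta ω j < delta ω i) : IsBlue ω N i := by
  refine ⟨Finset.mem_Icc.2 ⟨hi, by omega⟩, hω, fun hr => ?_⟩
  have := hr.2.2.1 j (Finset.mem_Icc.2 ⟨hij, hj⟩)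
  omega

/-- All heads in a window that spells a Dyck word are blue: each lies at a level above that of the
start of the window, to which the walk returns at its end. -/
theorem hasBlueRun_of_word {ω : ℕ → Bool} {N s k : ℕ} {p : DyckWord} (hp : p.semilength = k)
    (hN : s + 2 * k ≤ N) (h : word ω s (2 * k) = p.toList) : HasBlueRun ω N k := by
  refine ⟨s + 1, s + 2 * k, by omega, hN, fun i hi hω => ?_, ?_⟩
  · rw [Finset.mem_Icc] at hi
    obtain ⟨t, rfl⟩ : ∃ t, i = s + t + 1 := ⟨i - s - 1, by omega⟩
    have h1 := p.count_D_le_count_U t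
    rw [← h, take_word ω s (by omega)] at h1
    have h2 := delta_add ω s t
    have h3 := delta_succ ω (s + t)
    rw [if_pos hω] at h3
    have h4 := delta_add ω s (2 * k)
    rw [h, p.count_U_eq_count_D] at h4
    have hlt : delta ω (s + 2 * k) < delta ω (s + t + 1) := by omega
    refine isBlue_of_delta_lt (by omega) (lt_of_le_of_ne hi.2 ?_) hN hω hlt
    intro heq
    rw [heq] at hlt
    exact lt_irrefl _ hlt
  · rw [card_heads_Icc, h]
    exact hp

/-! ### Probability of a blue run -/

/-- The event that the tosses `s + 1, …, s + 2 * k` spell a Dyck word. -/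
def dyckWindow (s k : ℕ) : Set (ℕ → Bool) :=
  {ω | ∃ p : DyckWord, p.semilength = k ∧ word ω s (2 * k) = p.toList}

theorem dependsOn_dyckWindow (s k : ℕ) :
    DependsOn (· ∈ dyckWindow s k) (Finset.Icc (s + 1) (s + 2 * k) : Finset ℕ) := by
  intro ω ω' h
  simp [dyckWindow, word_congr (fun i hi => h i hi)]

theorem tossLaw_real_dyckWindow (s k : ℕ) :
    (tossLaw twoThirds).real (dyckWindow s k) = catalan k * (2 / 9) ^ k := by
  have e : dyckWindow s k =
      ⋃ p : {p : DyckWord // p.semilength = k}, {ω | word ω s (2 * k) = p.1.toList} := by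
    ext ω
    simp [dyckWindow]
  have hlen (p : {p : DyckWord // p.semilength = k}) : p.1.toList.length = 2 * k := by
    rw [← p.1.two_mul_semilength_eq_length, p.2]
  rw [e, measureReal_iUnion_fintype]
  · have hp (p : {p : DyckWord // p.semilength = k}) :
        (tossLaw twoThirds).real {ω | word ω s (2 * k) = p.1.toList} = (2 / 9) ^ k := by
      have h := tossLaw_real_word p.1.toList s
      rw [hlen, ← p.1.semilength_eq_count_D, p.2] at h
      rw [h, show p.1.toList.count DyckStep.U = k from p.2, ← mul_pow]
      norm_num
    simp only [hp, Finset.sum_const, Finset.card_univ,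
      DyckWord.card_dyckWord_semilength_eq_catalan, nsmul_eq_mul]
  · intro p q hpq
    refine Set.disjoint_left.2 fun ω hω hω' => hpq ?_
    exact Subtype.ext (DyckWord.ext (hω.symm.trans hω'))
  · intro p
    refine measurableSet_of_dependsOn (S := Finset.Icc (s + 1) (s + 2 * k)) ?_
    intro ω ω' h
    simp [word_congr (fun i hi => h i hi)]

/-- The first `m` disjoint windows of length `2 * k` are independent. -/
theorem tossLaw_real_iInter_dyckWindow_compl (k m : ℕ) :
    (tossLaw twoThirds).real {ω | ∀ j < m, ω ∉ dyckWindow (2 * k * j) k} =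
      (1 - catalan k * (2 / 9) ^ k) ^ m := by
  induction m with
  | zero => simp
  | succ m ih =>
    have e : {ω | ∀ j < m + 1, ω ∉ dyckWindow (2 * k * j) k} =
        {ω | ∀ j < m, ω ∉ dyckWindow (2 * k * j) k} ∩ (dyckWindow (2 * k * m) k)ᶜ := by
      ext ω
      simp only [Set.mem_ofPred_eq, Set.mem_inter_iff, Set.mem_compl_iff, Nat.forall_lt_succ_right]
    rw [e, tossLaw_real_inter (S := Finset.Icc 1 (2 * k * m))
      (T := Finset.Icc (2 * k * m + 1) (2 * k * m + 2 * k)), ih, pow_succ, probReal_compl_eq_one_sub,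
      tossLaw_real_dyckWindow]
    · exact measurableSet_of_dependsOn (dependsOn_dyckWindow _ _)
    · intro ω ω' h
      have hj (j : ℕ) (hj : j < m) : (ω ∈ dyckWindow (2 * k * j) k) =
          (ω' ∈ dyckWindow (2 * k * j) k) := by
        refine dependsOn_dyckWindow _ _ fun i hi => h i ?_
        have := Nat.mul_le_mul_left (2 * k) (show j + 1 ≤ m from hj)
        rw [mul_add, mul_one] at this
        simp only [Finset.coe_Icc, Set.mem_Icc] at hi ⊢
        omega
      simp only [Set.mem_ofPred_eq, eq_iff_iff]
      exact forall₂_congr fun j hjm => by rw [hj j hjm]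
    · intro ω ω' h
      have := dependsOn_dyckWindow (2 * k * m) k h
      exact congrArg Not this
    · rw [Finset.disjoint_left]
      intro i hi hi'
      rw [Finset.mem_Icc] at hi hi'
      omega

/-- Lower bound for the probability of a Dyck window, of exponential order `(8 / 9) ^ k`. -/
theorem le_catalan_mul {k : ℕ} (hk : 0 < k) :
    (8 / 9 : ℝ) ^ k / (2 * k * (k + 1)) ≤ catalan k * (2 / 9) ^ k := by
  have h : (4 : ℝ) ^ k ≤ 2 * k * ((k + 1) * catalan k) := by
    have := Nat.four_pow_le_two_mul_self_mul_centralBinom k hk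
    rw [← succ_mul_catalan_eq_centralBinom] at this
    exact_mod_cast this
  rw [div_le_iff₀ (by positivity), show (8 / 9 : ℝ) = 4 * (2 / 9) by norm_num, mul_pow]
  calc (4 : ℝ) ^ k * (2 / 9) ^ k ≤ 2 * k * ((k + 1) * catalan k) * (2 / 9) ^ k := by gcongr
    _ = _ := by ring


/-- With at least `(5 / 4) ^ k` tosses, the expected number of Dyck windows among the disjoint ones
is, up to a loss of `1` from rounding, at least `(10 / 9) ^ k` over a cubic polynomial, where
`10 / 9 = 5 / 4 * (8 / 9)`. -/
theorem le_tossLaw_real_hasBlueRun {k N : ℕ} (hk : 0 < k) (hN : (5 / 4 : ℝ) ^ k ≤ N) :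
    1 - Real.exp (1 - (10 / 9) ^ k / (4 * k ^ 2 * (k + 1))) ≤
      (tossLaw twoThirds).real {ω | HasBlueRun ω N k} := by
  set q : ℝ := catalan k * (2 / 9) ^ k with hq
  set m := N / (2 * k) with hm
  have hq1 : q ≤ 1 := by
    rw [hq, ← tossLaw_real_dyckWindow 0 k]
    exact measureReal_le_one
  have hq0 : 0 ≤ q := by positivity
  have hmeas : MeasurableSet {ω | ∀ j < m, ω ∉ dyckWindow (2 * k * j) k} := by
    simp only [Set.ofPred_forall]
    exact .iInter fun j => .iInter fun _ =>
      (measurableSet_of_dependsOn (dependsOn_dyckWindow _ _)).compl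
  have hsub : {ω | ∀ j < m, ω ∉ dyckWindow (2 * k * j) k}ᶜ ⊆ {ω | HasBlueRun ω N k} := by
    intro ω hω
    simp only [Set.mem_compl_iff, Set.mem_ofPred_eq, not_forall, not_not] at hω
    obtain ⟨j, hj, p, hp, hw⟩ := hω
    refine hasBlueRun_of_word hp ?_ hw
    calc 2 * k * j + 2 * k = 2 * k * (j + 1) := by ring
      _ ≤ 2 * k * m := Nat.mul_le_mul_left _ hj
      _ ≤ N := Nat.mul_div_le _ _
  have hmono := measureReal_mono (μ := tossLaw twoThirds) hsub
  rw [probReal_compl_eq_one_sub hmeas, tossLaw_real_iInter_dyckWindow_compl] at hmono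
  refine le_trans ?_ hmono
  have hm1 : (N : ℝ) / (2 * k) - 1 ≤ m := by
    have := Nat.lt_floor_add_one ((N : ℝ) / ((2 * k : ℕ) : ℝ))
    rw [Nat.floor_div_eq_div] at this
    push_cast at this
    linarith
  have hmq : (10 / 9 : ℝ) ^ k / (4 * k ^ 2 * (k + 1)) - 1 ≤ m * q := by
    calc (10 / 9 : ℝ) ^ k / (4 * k ^ 2 * (k + 1)) - 1
        = (5 / 4) ^ k / (2 * k) * ((8 / 9) ^ k / (2 * k * (k + 1))) - 1 := by
          rw [show (10 / 9 : ℝ) = 5 / 4 * (8 / 9) by norm_num, mul_pow]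
          field_simp
          ring
      _ ≤ N / (2 * k) * q - 1 := by
          have := le_catalan_mul hk
          gcongr
      _ ≤ (N / (2 * k) - 1) * q := by linarith
      _ ≤ m * q := by gcongr
  have : (1 - q) ^ m ≤ Real.exp (-(m * q)) := by
    rw [show -((m : ℝ) * q) = m * (-q) by ring, Real.exp_nat_mul]
    exact pow_le_pow_left₀ (by linarith) (by linarith [Real.add_one_le_exp (-q)]) _
  have : Real.exp (-(m * q)) ≤ Real.exp (1 - (10 / 9) ^ k / (4 * k ^ 2 * (k + 1))) :=
    Real.exp_le_exp.2 (by linarith)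
  linarith

theorem tendsto_pow_div_cubic :
    Filter.Tendsto (fun k : ℕ => (10 / 9 : ℝ) ^ k / (4 * k ^ 2 * (k + 1)))
      Filter.atTop Filter.atTop := by
  have h1 := tendsto_pow_const_div_const_pow_of_one_lt 3 (show (1 : ℝ) < 10 / 9 by norm_num)
  have h2 : Filter.Tendsto (fun k : ℕ => (k : ℝ) ^ 3 / (10 / 9) ^ k) Filter.atTop
      (nhdsWithin 0 (Set.Ioi 0)) := by
    refine tendsto_nhdsWithin_iff.2 ⟨h1, ?_⟩
    filter_upwards [Filter.eventually_gt_atTop 0] with k hk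
    rw [Set.mem_Ioi]
    positivity
  have h3 := h2.inv_tendsto_nhdsGT_zero.atTop_div_const (show (0 : ℝ) < 8 by norm_num)
  refine Filter.tendsto_atTop_mono' _ ?_ h3
  filter_upwards [Filter.eventually_gt_atTop 0] with k hk
  have hk1 : (1 : ℝ) ≤ k := by exact_mod_cast hk
  rw [Pi.inv_apply, inv_div, div_div]
  refine div_le_div_of_nonneg_left (by positivity) (by positivity) ?_
  calc 4 * (k : ℝ) ^ 2 * (k + 1) ≤ 4 * (k : ℝ) ^ 2 * (k + k) := by gcongr
    _ = (k : ℝ) ^ 3 * 8 := by ring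

/-- About `(5 / 4) ^ k` tosses suffice for a run of `k` blue heads with probability close to `1`. -/
theorem eventually_le_tossLaw_real_hasBlueRun {δ : ℝ} (hδ : δ < 1) :
    ∀ᶠ k : ℕ in Filter.atTop, ∀ N : ℕ, (5 / 4 : ℝ) ^ k ≤ N →
      δ ≤ (tossLaw twoThirds).real {ω | HasBlueRun ω N k} := by
  have h : Filter.Tendsto (fun k : ℕ => 1 - Real.exp (1 - (10 / 9) ^ k / (4 * k ^ 2 * (k + 1))))
      Filter.atTop (nhds (1 - 0)) :=
    (Real.tendsto_exp_atBot.comp <| by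
      simpa only [sub_eq_add_neg, Function.comp_apply] using Filter.tendsto_atBot_add_const_left _ (1 : ℝ)
        (Filter.tendsto_neg_atTop_atBot.comp tendsto_pow_div_cubic)).const_sub 1
  rw [sub_zero] at h
  filter_upwards [h.eventually_const_le hδ, Filter.eventually_gt_atTop 0] with k hk hk0 N hN
  exact hk.trans (le_tossLaw_real_hasBlueRun hk0 hN)

/-! ### The longest blue run: monotonicity, measurability, integrability -/

/-- Further tosses only add levels below which the walk may drop, so blue heads stay blue. -/
theorem HasBlueRun.mono {ω : ℕ → Bool} {M N k : ℕ} (hMN : M ≤ N) (h : HasBlueRun ω M k) :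
    HasBlueRun ω N k := by
  obtain ⟨a, b, ha, hb, hblue, hcard⟩ := h
  refine ⟨a, b, ha, hb.trans hMN, fun i hi hω => ?_, hcard⟩
  obtain ⟨hiM, -, hred⟩ := hblue i hi hω
  refine ⟨Finset.Icc_subset_Icc_right hMN hiM, hω, fun hr => hred ?_⟩
  exact ⟨hiM, hω, fun j hj => hr.2.2.1 j (Finset.Icc_subset_Icc_right hMN hj), hr.2.2.2⟩

theorem HasBlueRun.le_longestBlueRun {ω : ℕ → Bool} {N k : ℕ} (h : HasBlueRun ω N k) :
    k ≤ longestBlueRun ω N :=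
  le_csSup ⟨N, fun _ => HasBlueRun.le⟩ h

theorem longestBlueRun_mono (ω : ℕ → Bool) {M N : ℕ} (h : M ≤ N) :
    longestBlueRun ω M ≤ longestBlueRun ω N :=
  ((hasBlueRun_longestBlueRun ω M).mono h).le_longestBlueRun

theorem HasBlueRun.le_headCount {ω : ℕ → Bool} {N k : ℕ} (h : HasBlueRun ω N k) :
    k ≤ headCount ω N := by
  obtain ⟨a, b, ha, hb, -, rfl⟩ := h
  exact Finset.card_le_card (Finset.filter_subset_filter _ (Finset.Icc_subset_Icc ha hb))

theorem headCount_le (ω : ℕ → Bool) (m : ℕ) : headCount ω m ≤ m := by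
  simpa [headCount] using Finset.card_filter_le (Finset.Icc 1 m) fun j => ω j = true

theorem headCount_congr {ω ω' : ℕ → Bool} {m : ℕ} (h : ∀ i ∈ Finset.Icc 1 m, ω i = ω' i) :
    headCount ω m = headCount ω' m := by
  unfold headCount
  rw [Finset.filter_congr fun i hi => by rw [h i hi]]

theorem delta_congr {ω ω' : ℕ → Bool} {m : ℕ} (h : ∀ i ∈ Finset.Icc 1 m, ω i = ω' i) :
    delta ω m = delta ω' m := by
  unfold delta tailCount
  rw [headCount_congr h, Finset.filter_congr fun i hi => by rw [h i hi]]

theorem IsRed.congr {ω ω' : ℕ → Bool} {N i : ℕ} (h : ∀ i ∈ Finset.Icc 1 N, ω i = ω' i)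
    (hr : IsRed ω N i) : IsRed ω' N i := by
  have hδ (j : ℕ) (hj : j ≤ N) : delta ω' j = delta ω j :=
    (delta_congr fun i hi => h i (Finset.Icc_subset_Icc_right hj hi)).symm
  obtain ⟨hi, hω, h1, h2⟩ := hr
  have hiN := (Finset.mem_Icc.1 hi).2
  refine ⟨hi, (h i hi).symm.trans hω, fun j hj => ?_, fun k hk hle => ?_⟩
  · rw [hδ i hiN, hδ j (Finset.mem_Icc.1 hj).2]
    exact h1 j hj
  · have hki := (Finset.mem_Ico.1 hk).2
    rw [hδ i hiN, hδ k (by omega)] at hle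
    obtain ⟨l, hl, hlt⟩ := h2 k hk hle
    have hli := (Finset.mem_Ioo.1 hl).2
    exact ⟨l, hl, by rwa [hδ i hiN, hδ l (by omega)]⟩

theorem HasBlueRun.congr {ω ω' : ℕ → Bool} {N k : ℕ} (h : ∀ i ∈ Finset.Icc 1 N, ω i = ω' i)
    (hr : HasBlueRun ω N k) : HasBlueRun ω' N k := by
  obtain ⟨a, b, ha, hb, hblue, hcard⟩ := hr
  have hab (i : ℕ) (hi : i ∈ Finset.Icc a b) : ω i = ω' i :=
    h i (Finset.Icc_subset_Icc ha hb hi)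
  refine ⟨a, b, ha, hb, fun i hi hω => ?_, ?_⟩
  · obtain ⟨hiN, hω', hred⟩ := hblue i hi ((hab i hi).trans hω)
    exact ⟨hiN, hω, fun hr => hred (hr.congr fun i hi => (h i hi).symm)⟩
  · rw [← hcard, Finset.filter_congr fun i hi => by rw [← hab i hi]]

theorem measurable_longestBlueRun (N : ℕ) : Measurable fun ω => longestBlueRun ω N := by
  refine measurable_of_dependsOn (S := Finset.Icc 1 N) fun ω ω' h => ?_
  unfold longestBlueRun
  congr 1
  ext k
  exact ⟨HasBlueRun.congr h, HasBlueRun.congr fun i hi => (h i hi).symm⟩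

theorem measurable_headCount (m : ℕ) : Measurable fun ω => headCount ω m :=
  measurable_of_dependsOn (S := Finset.Icc 1 m) fun _ _ h => headCount_congr h

theorem measurableSet_headCount_eq (m n : ℕ) : MeasurableSet {ω | headCount ω m = n} :=
  measurable_headCount m (measurableSet_singleton n)

theorem measurable_headTime (n : ℕ) : Measurable fun ω => headTime ω n := by
  refine measurable_to_countable' fun m => ?_
  have hmem (m : ℕ) : MeasurableSet {ω | headCount ω m = n ∧ ∀ j < m, headCount ω j ≠ n} := by
    simp only [Set.ofPred_and, Set.ofPred_forall]
    exact (measurableSet_headCount_eq m n).inter <| .iInter fun j => .iInter fun _ =>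
      (measurableSet_headCount_eq j n).compl
  have hnone : MeasurableSet {ω | ∀ j, headCount ω j ≠ n} := by
    simp only [Set.ofPred_forall]
    exact .iInter fun j => (measurableSet_headCount_eq j n).compl
  have e : (fun ω => headTime ω n) ⁻¹' {m} =
      {ω | headCount ω m = n ∧ ∀ j < m, headCount ω j ≠ n} ∪
        {ω | m = 0 ∧ ∀ j, headCount ω j ≠ n} := by
    ext ω
    simp only [Set.mem_preimage, Set.mem_singleton_iff, Set.mem_union, Set.mem_ofPred_eq]
    constructor
    · rintro rfl
      by_cases h : ∃ j, headCount ω j = n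
      · exact .inl ⟨Nat.sInf_mem (s := {m | headCount ω m = n}) h,
          fun j hj => Nat.notMem_of_lt_sInf (s := {m | headCount ω m = n}) hj⟩
      · rw [not_exists] at h
        refine .inr ⟨?_, h⟩
        exact Nat.sInf_eq_zero.2 (.inr (Set.eq_empty_of_forall_notMem h))
    · rintro (⟨h, hlt⟩ | ⟨rfl, h⟩)
      · refine le_antisymm (Nat.sInf_le h) (not_lt.1 fun hj => ?_)
        exact hlt _ hj (Nat.sInf_mem (s := {m | headCount ω m = n}) ⟨m, h⟩)
      · exact Nat.sInf_eq_zero.2 (.inr (Set.eq_empty_of_forall_notMem h))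
  rw [e]
  refine (hmem m).union ?_
  simp only [Set.ofPred_and]
  exact (MeasurableSet.const _).inter hnone

theorem measurable_longestBlueRun_headTime (n : ℕ) :
    Measurable fun ω => longestBlueRun ω (headTime ω n) :=
  (measurable_from_prod_countable_left (f := fun x : (ℕ → Bool) × ℕ => longestBlueRun x.1 x.2)
    measurable_longestBlueRun).comp (measurable_id.prodMk (measurable_headTime n))

/-- Before `n` heads have appeared no run is longer than `n`; this also covers the sequences with
fewer than `n` heads, for which `headTime` is `0`. The bound makes the expectation meaningful. -/
theorem longestBlueRun_headTime_le (ω : ℕ → Bool) (n : ℕ) :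
    longestBlueRun ω (headTime ω n) ≤ n := by
  refine (hasBlueRun_longestBlueRun ω _).le_headCount.trans ?_
  by_cases h : ∃ j, headCount ω j = n
  · exact (Nat.sInf_mem (s := {m | headCount ω m = n}) h).le
  · have : headTime ω n = 0 :=
      Nat.sInf_eq_zero.2 (.inr (Set.eq_empty_of_forall_notMem (not_exists.1 h)))
    rw [this]
    exact (headCount_le ω 0).trans n.zero_le

theorem integrable_longestBlueRun (p : unitInterval) (N : ℕ) :
    Integrable (fun ω => (longestBlueRun ω N : ℝ)) (tossLaw p) := by
  refine .of_bound ((measurable_from_top (f := Nat.cast)).comp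
    (measurable_longestBlueRun N)).aestronglyMeasurable N (.of_forall fun ω => ?_)
  simpa using (hasBlueRun_longestBlueRun ω N).le

theorem integrable_longestBlueRun_headTime (p : unitInterval) (n : ℕ) :
    Integrable (fun ω => (longestBlueRun ω (headTime ω n) : ℝ)) (tossLaw p) := by
  refine .of_bound ((measurable_from_top (f := Nat.cast)).comp
    (measurable_longestBlueRun_headTime n)).aestronglyMeasurable n (.of_forall fun ω => ?_)
  simpa using longestBlueRun_headTime_le ω n

/-! ### Expected length of the longest blue run -/

theorem exists_headCount_eq {ω : ℕ → Bool} {m n : ℕ} (h : n ≤ headCount ω m) :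
    ∃ j, headCount ω j = n := by
  induction m with
  | zero => exact ⟨0, le_antisymm ((headCount_le ω 0).trans n.zero_le) h⟩
  | succ m ih =>
    rcases h.eq_or_lt with h | h
    · exact ⟨m + 1, h.symm⟩
    · refine ih ?_
      rw [headCount_succ] at h
      split_ifs at h <;> omega

/-- A blue run of `k` heads forces `k` heads, so `n` heads appear with probability at least `δ` for
every `δ < 1`. -/
theorem ae_exists_headCount_eq (n : ℕ) :
    ∀ᵐ ω ∂tossLaw twoThirds, ∃ m, headCount ω m = n := by
  have hmeas : MeasurableSet {ω | ∃ m, headCount ω m = n} := by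
    simp only [Set.ofPred_exists]
    exact .iUnion fun m => measurableSet_headCount_eq m n
  have hone : (tossLaw twoThirds).real {ω | ∃ m, headCount ω m = n} = 1 := by
    refine le_antisymm measureReal_le_one (le_of_forall_lt fun δ hδ => ?_)
    obtain ⟨δ', hδ', h1⟩ := exists_between hδ
    obtain ⟨k, hk, hn⟩ := ((eventually_le_tossLaw_real_hasBlueRun h1).and
      (Filter.eventually_ge_atTop n)).exists
    obtain ⟨N, hN⟩ := exists_nat_ge ((5 / 4 : ℝ) ^ k)
    refine hδ'.trans_le ((hk N hN).trans (measureReal_mono fun ω hω => ?_))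
    exact exists_headCount_eq (hn.trans (HasBlueRun.le_headCount hω))
  rw [measureReal_def, ENNReal.toReal_eq_one_iff] at hone
  exact (mem_ae_iff_prob_eq_one hmeas).2 hone

theorem integral_longestBlueRun_le_headTime (n : ℕ) :
    ∫ ω, (longestBlueRun ω n : ℝ) ∂tossLaw twoThirds ≤
      ∫ ω, (longestBlueRun ω (headTime ω n) : ℝ) ∂tossLaw twoThirds := by
  refine integral_mono_ae (integrable_longestBlueRun _ n)
    (integrable_longestBlueRun_headTime _ n) ?_
  filter_upwards [ae_exists_headCount_eq n] with ω hω
  have h : headCount ω (headTime ω n) = n := Nat.sInf_mem (s := {m | headCount ω m = n}) hω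
  exact_mod_cast longestBlueRun_mono ω (h.symm.le.trans (headCount_le ω _))

theorem eventually_two_mul_logb_le_integral : ∀ᶠ N : ℕ in Filter.atTop,
    2 * Real.logb 2 (N : ℝ) ≤ ∫ ω, (longestBlueRun ω N : ℝ) ∂tossLaw twoThirds := by
  have hlog : Filter.Tendsto (fun N => Nat.log 2 N) Filter.atTop Filter.atTop :=
    Filter.tendsto_atTop.2 fun b => (Filter.eventually_ge_atTop (2 ^ b)).mono fun N hN =>
      Nat.le_log_of_pow_le one_lt_two hN
  have h3 : Filter.Tendsto (fun N => 3 * Nat.log 2 N) Filter.atTop Filter.atTop :=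
    Filter.tendsto_atTop_mono (fun _ => Nat.le_mul_of_pos_left _ three_pos) hlog
  -- `5 / 6 * 3 > 2`, and `(5 / 4) ^ 3 < 2` lets runs of `3 * log₂ N` heads be reached in `N` tosses.
  filter_upwards [h3.eventually (eventually_le_tossLaw_real_hasBlueRun
      (show (5 / 6 : ℝ) < 1 by norm_num)), hlog.eventually_ge_atTop 4,
    Filter.eventually_gt_atTop 0] with N hN h4 hN0
  set m := Nat.log 2 N with hm
  have h4' : (4 : ℝ) ≤ m := by exact_mod_cast h4
  have hpow : (5 / 4 : ℝ) ^ (3 * m) ≤ N := by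
    calc (5 / 4 : ℝ) ^ (3 * m) ≤ 2 ^ m := by
          rw [pow_mul]
          gcongr
          norm_num
      _ ≤ N := by exact_mod_cast Nat.pow_log_le_self 2 hN0.ne'
  have hprob := hN N hpow
  have hle : (tossLaw twoThirds).real {ω | HasBlueRun ω N (3 * m)} ≤
      (tossLaw twoThirds).real {ω | (3 * m : ℝ) ≤ longestBlueRun ω N} :=
    measureReal_mono fun ω hω => by
      have := HasBlueRun.le_longestBlueRun hω
      show (3 * m : ℝ) ≤ longestBlueRun ω N
      exact_mod_cast this
  have hmarkov := mul_meas_ge_le_integral_of_nonneg (μ := tossLaw twoThirds)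
    (.of_forall fun ω => Nat.cast_nonneg _) (integrable_longestBlueRun twoThirds N) (3 * m : ℝ)
  have hlogb : Real.logb 2 N ≤ m + 1 := by
    rw [Real.logb_le_iff_le_rpow (by norm_num) (by exact_mod_cast hN0)]
    exact_mod_cast (Nat.lt_pow_succ_log_self (by norm_num) N).le
  calc 2 * Real.logb 2 N ≤ 3 * m * (5 / 6) := by linarith
    _ ≤ 3 * m * (tossLaw twoThirds).real {ω | (3 * m : ℝ) ≤ longestBlueRun ω N} := by
      gcongr
      exact hprob.trans hle
    _ ≤ _ := hmarkov

theorem pow_le_two_rpow_half (k : ℕ) : (5 / 4 : ℝ) ^ k ≤ 2 ^ ((k : ℝ) / 2) := by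
  rw [div_eq_inv_mul (k : ℝ), Real.rpow_mul (by norm_num), Real.rpow_natCast]
  gcongr
  rw [Real.le_rpow_inv_iff_of_pos (by norm_num) (by norm_num) (by norm_num)]
  norm_num

end CoinRuns

/-- Eventual lower bound for the expected longest blue run, for `N` tosses and for tossing until
`N` heads have appeared, and the bound on the number of tosses needed for a run of length `k`. -/
theorem proposition2p5 :
    (∀ᶠ N : ℕ in Filter.atTop,
      2 * Real.logb 2 (N : ℝ) ≤
        ∫ ω, (CoinRuns.longestBlueRun ω N : ℝ) ∂(CoinRuns.tossLaw CoinRuns.twoThirds)) ∧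
    (∀ᶠ N : ℕ in Filter.atTop,
      2 * Real.logb 2 (N : ℝ) ≤
        ∫ ω, (CoinRuns.longestBlueRun ω (CoinRuns.headTime ω N) : ℝ)
          ∂(CoinRuns.tossLaw CoinRuns.twoThirds)) ∧
    (∀ δ : ℝ, δ < 1 → ∃ C : ℝ, 0 < C ∧ ∃ k₀ : ℕ, ∀ k : ℕ, k₀ ≤ k →
      ∀ N : ℕ, C * (2 : ℝ) ^ ((k : ℝ) / 2) ≤ (N : ℝ) →
        δ ≤ (CoinRuns.tossLaw CoinRuns.twoThirds).real {ω | CoinRuns.HasBlueRun ω N k}) := by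
  refine ⟨CoinRuns.eventually_two_mul_logb_le_integral, ?_, fun δ hδ => ?_⟩
  · filter_upwards [CoinRuns.eventually_two_mul_logb_le_integral] with N hN
    exact hN.trans (CoinRuns.integral_longestBlueRun_le_headTime N)
  · obtain ⟨k₀, hk₀⟩ :=
      Filter.eventually_atTop.1 (CoinRuns.eventually_le_tossLaw_real_hasBlueRun hδ)
    refine ⟨1, one_pos, k₀, fun k hk N hN => hk₀ k hk N ?_⟩
    rw [one_mul] at hN
    exact (CoinRuns.pow_le_two_rpow_half k).trans hN
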